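/- For integers $k\ge 0$ and $n\ge 1$ let $\mathrm{Dyck}_{k,n}:\{0,1\}^n\to\{0,1\}$ be the function with $\mathrm{Dyck}_{k,n}(x)=1$ if and only if the word obtained from $x$ by writing "(" for each bit $0$ and ")" for each bit $1$ is a balanced sequence of parentheses in which the number of opening parentheses that are not yet closed never exceeds $k$. For $f:\{0,1\}^n\to\{0,1\}$ let $Q(f)$ be its bounded-error quantum query complexity: the smallest number of uses of the query unitary $|i\rangle|z\rangle|w\rangle\mapsto|i\rangle|z+x_i \bmod 2\rangle|w\rangle$ in an algorithm that starts in a fixed basis state, alternates arbitrary input-independent unitaries with queries, ends with a measurement, and outputs $f(x)$ with probability at least $2/3$ on every input $x\in\{0,1\}^n$. Theorem. There exist positive integers $c_1,c_2$ and a real number $c>0$ such that for all integers $\ell\ge 1$ and $m\ge 1$ $$Q\left(\mathrm{Dyck}_{c_1\ell m,\;c_2(2m)^\ell}\right)\;\ge\; c\,m^\ell .$$ In other words, the complexity is $\Omega(m^\ell)$ with a constant that does not depend on $\ell$ or $m$. -/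

import Mathlib

open scoped ENNReal

noncomputable section

/-! ## The quantum query model -/

namespace QuantumQuery

/-- Labels of the computational basis states `|i⟩|z⟩|w⟩`: the index `i` of the queried variable,
the output bit `z`, and a basis state `w` of a `d`-dimensional work space. -/
abbrev Label (n d : ℕ) : Type := Fin n × Bool × Fin d

/-- The state space spanned by the orthonormal basis `|i⟩|z⟩|w⟩`. -/
abbrev StateSpace (n d : ℕ) : Type := EuclideanSpace ℂ (Label n d)

/-- The permutation `(i, z, w) ↦ (i, z + x_i mod 2, w)` of the basis labels. -/
def oraclePerm {n : ℕ} (x : Fin n → Bool) (d : ℕ) : Equiv.Perm (Label n d) :=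
  Function.Involutive.toPerm (fun b => (b.1, xor b.2.1 (x b.1), b.2.2)) (by
    rintro ⟨i, z, w⟩
    simp)

/-- The query unitary `|i⟩|z⟩|w⟩ ↦ |i⟩|z + x_i mod 2⟩|w⟩` of the input `x`. -/
def oracle {n : ℕ} (x : Fin n → Bool) (d : ℕ) : StateSpace n d ≃ₗᵢ[ℂ] StateSpace n d :=
  LinearIsometryEquiv.piLpCongrLeft 2 ℂ ℂ (oraclePerm x d)

/-- A quantum query algorithm on `n` input bits. It starts in the basis state `start`, applies the
unitary `unitary 0`, then `queries` times the query unitary, the `t`-th query being followed by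
`unitary t`, and finally measures in the computational basis; `output` is the answer given on each
measurement result. The work space has arbitrary finite dimension `dim`. -/
structure Algorithm (n : ℕ) where
  dim : ℕ
  queries : ℕ
  start : Label n dim
  unitary : ℕ → (StateSpace n dim ≃ₗᵢ[ℂ] StateSpace n dim)
  output : Label n dim → Bool

/-- The state on input `x` after `t` queries and the unitary that follows the last of them. -/
def Algorithm.stateAfter {n : ℕ} (A : Algorithm n) (x : Fin n → Bool) : ℕ → StateSpace n A.dim
  | 0 => A.unitary 0 (EuclideanSpace.single A.start 1)
  | t + 1 => A.unitary (t + 1) (oracle x A.dim (A.stateAfter x t))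

/-- The probability that the final measurement on input `x` makes the algorithm answer `b`. -/
def Algorithm.prob {n : ℕ} (A : Algorithm n) (x : Fin n → Bool) (b : Bool) : ℝ :=
  ∑ s : Label n A.dim, if A.output s = b then ‖A.stateAfter x A.queries s‖ ^ 2 else 0

/-- The algorithm outputs `f x` with probability at least `2/3` on every input `x`. -/
def Algorithm.Computes {n : ℕ} (A : Algorithm n) (f : (Fin n → Bool) → Bool) : Prop :=
  ∀ x, 2 / 3 ≤ A.prob x (f x)

/-- The quantum query complexity `Q(f)`: the smallest number of queries of an algorithm that
computes `f` (it would be `⊤` if there were none). -/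
def queryComplexity {n : ℕ} (f : (Fin n → Bool) → Bool) : ℕ∞ :=
  ⨅ A : {A : Algorithm n // A.Computes f}, (A.1.queries : ℕ∞)

end QuantumQuery

/-! ## Dyck languages of bounded depth -/

/-- The language of Dyck words (`U` is an opening and `D` a closing parenthesis) in which the number
of opening parentheses that are not closed yet never exceeds `k`. -/
def boundedDyckLanguage (k : ℕ) : Language DyckStep :=
  {w | (∃ p : DyckWord, p.toList = w) ∧
    ∀ i, (w.take i).count DyckStep.U ≤ (w.take i).count DyckStep.D + k}

/-- The word described by `x`: bit `0` (`false`) is `(` and bit `1` (`true`) is `)`. -/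
def parenWord {n : ℕ} (x : Fin n → Bool) : List DyckStep :=
  List.ofFn fun i => if x i then DyckStep.D else DyckStep.U

open Classical in
/-- The query problem `Dyck_{k,n}`. -/
def dyck (k n : ℕ) (x : Fin n → Bool) : Bool :=
  decide (parenWord x ∈ boundedDyckLanguage k)

end

/-! The lower bound is an adversary argument over single bit flips. For a set `X` of yes-inputs and
a set `Y` of no-inputs, sum the overlaps of the algorithm's states over all pairs of `X × Y` at
Hamming distance one. The sum starts at the number of pairs, must end a constant factor lower, and
drops by at most `|X| + |Y|` per query. If every input has at least `s` flips into the other set,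
then `s / 36` queries are needed (`Algorithm.le_queries_of_flips`).

The hard inputs are self-similar words. A level-`ℓ` word has total height `1` or `-1`, just like a
letter, so it can replace a letter in the next level. Among `2m` blocks, having `m` or `m + 1`
descending ones gives height `0` or `-2`, which one further `(` turns into `1` or `-1`. Switching
any of at least `m` blocks switches the whole word, so the number of useful flips multiplies by `m`
per level (`pow_le_flipCount_thresholdWords`), while the height range only grows by `2m`
(`heightsWithin_of_mem_thresholdWords`). Framing such a word by parentheses makes it balanced
exactly when its height is `1`. -/

namespace QuantumQuery

/-- The input obtained from `x` by flipping bit `i`. -/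
def flipBit {n : ℕ} (x : Fin n → Bool) (i : Fin n) : Fin n → Bool :=
  Function.update x i (!x i)

@[simp]
theorem flipBit_flipBit {n : ℕ} (x : Fin n → Bool) (i : Fin n) :
    flipBit (flipBit x i) i = x := by
  simp [flipBit]

theorem flipBit_of_ne {n : ℕ} (x : Fin n → Bool) {i j : Fin n} (h : j ≠ i) :
    flipBit x i j = x j := by
  simp [flipBit, h]

theorem oracle_apply {n : ℕ} (x : Fin n → Bool) (d : ℕ) (ψ : StateSpace n d) (b : Label n d) :
    oracle x d ψ b = ψ (oraclePerm x d b) := by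
  rfl

theorem oraclePerm_fst {n : ℕ} (x : Fin n → Bool) (d : ℕ) (b : Label n d) :
    (oraclePerm x d b).1 = b.1 := rfl

/-! ### Query weights and overlaps of states -/

/-- The probability that a measurement of the query register in the state `ψ` yields `i`. -/
noncomputable def queryWeight {n d : ℕ} (ψ : StateSpace n d) (i : Fin n) : ℝ :=
  ∑ b : Label n d, if b.1 = i then ‖ψ b‖ ^ 2 else 0

theorem queryWeight_nonneg {n d : ℕ} (ψ : StateSpace n d) (i : Fin n) : 0 ≤ queryWeight ψ i :=
  Finset.sum_nonneg fun b _ => by split_ifs <;> positivity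

theorem sum_queryWeight {n d : ℕ} (ψ : StateSpace n d) : ∑ i, queryWeight ψ i = ‖ψ‖ ^ 2 := by
  unfold queryWeight
  rw [Finset.sum_comm, EuclideanSpace.norm_sq_eq]
  simp

theorem queryWeight_oracle {n d : ℕ} (x : Fin n → Bool) (ψ : StateSpace n d) (i : Fin n) :
    queryWeight (oracle x d ψ) i = queryWeight ψ i := by
  unfold queryWeight
  exact Fintype.sum_equiv (oraclePerm x d) _ _ fun b => by
    rw [oracle_apply, oraclePerm_fst]

/-- The real part of the inner product of two states. -/
noncomputable def overlap {n d : ℕ} (ψ φ : StateSpace n d) : ℝ :=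
  ∑ b, (ψ b * starRingEnd ℂ (φ b)).re

theorem overlap_eq_inner {n d : ℕ} (ψ φ : StateSpace n d) : overlap ψ φ = (inner ℂ φ ψ).re := by
  simp [overlap, PiLp.inner_apply]

theorem overlap_map {n d : ℕ} (U : StateSpace n d ≃ₗᵢ[ℂ] StateSpace n d) (ψ φ : StateSpace n d) :
    overlap (U ψ) (U φ) = overlap ψ φ := by
  simp [overlap_eq_inner]

theorem overlap_self {n d : ℕ} (ψ : StateSpace n d) : overlap ψ ψ = ‖ψ‖ ^ 2 := by
  rw [overlap_eq_inner, inner_self_eq_norm_sq_to_K]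
  norm_cast

theorem abs_re_mul_conj_le (a b : ℂ) : |(a * starRingEnd ℂ b).re| ≤ ‖a‖ * ‖b‖ := by
  simpa using Complex.abs_re_le_norm (a * starRingEnd ℂ b)

/-- One query decreases the overlap of the states of two inputs that differ in bit `i` only by no
more than the weights with which the two states query `i`. -/
theorem overlap_sub_overlap_oracle_le {n d : ℕ} (x : Fin n → Bool) (i : Fin n)
    (ψ φ : StateSpace n d) :
    overlap ψ φ - overlap (oracle x d ψ) (oracle (flipBit x i) d φ) ≤
      queryWeight ψ i + queryWeight φ i := by
  -- Applying the same query unitary to both states preserves the overlap, so only basis states with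
  -- index `i`, where the two oracles differ, contribute to the drop.
  have hx : overlap ψ φ = overlap (oracle x d ψ) (oracle x d φ) := (overlap_map _ _ _).symm
  have hψ := queryWeight_oracle x ψ i
  have h₁ := queryWeight_oracle x φ i
  have h₂ := queryWeight_oracle (flipBit x i) φ i
  have key : overlap (oracle x d ψ) (oracle x d φ) -
      overlap (oracle x d ψ) (oracle (flipBit x i) d φ) ≤
      queryWeight (oracle x d ψ) i + (queryWeight (oracle x d φ) i +
        queryWeight (oracle (flipBit x i) d φ) i) / 2 := by
    unfold overlap queryWeight
    rw [← Finset.sum_sub_distrib, ← Finset.sum_add_distrib, Finset.sum_div,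
      ← Finset.sum_add_distrib]
    refine Finset.sum_le_sum fun b _ => ?_
    by_cases hb : b.1 = i
    · simp only [hb, if_true]
      have e₁ := (abs_le.1 (abs_re_mul_conj_le (oracle x d ψ b) (oracle x d φ b))).2
      have e₂ := (abs_le.1 (abs_re_mul_conj_le (oracle x d ψ b)
        (oracle (flipBit x i) d φ b))).1
      nlinarith [sq_nonneg (‖oracle x d ψ b‖ - ‖oracle x d φ b‖),
        sq_nonneg (‖oracle x d ψ b‖ - ‖oracle (flipBit x i) d φ b‖)]
    · have : oracle (flipBit x i) d φ b = oracle x d φ b := by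
        have : oraclePerm (flipBit x i) d b = oraclePerm x d b := by
          refine Prod.ext rfl (Prod.ext ?_ rfl)
          change xor b.2.1 (flipBit x i b.1) = xor b.2.1 (x b.1)
          rw [flipBit_of_ne x hb]
        rw [oracle_apply, oracle_apply, this]
      simp [hb, this]
  linarith

namespace Algorithm

variable {n : ℕ} (A : Algorithm n)

theorem norm_stateAfter (x : Fin n → Bool) (t : ℕ) : ‖A.stateAfter x t‖ = 1 := by
  induction t with
  | zero => simp [stateAfter]
  | succ t ih => simp [stateAfter, ih]

theorem prob_add_prob_not (x : Fin n → Bool) (b : Bool) : A.prob x b + A.prob x (!b) = 1 := by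
  have h : ∑ s, ‖A.stateAfter x A.queries s‖ ^ 2 = 1 := by
    rw [← EuclideanSpace.norm_sq_eq, norm_stateAfter, one_pow]
  rw [← h, prob, prob, ← Finset.sum_add_distrib]
  refine Finset.sum_congr rfl fun s _ => ?_
  cases A.output s <;> cases b <;> simp

/-- The final states of two inputs with different answers are far apart. -/
theorem overlap_final_le {f : (Fin n → Bool) → Bool} (hA : A.Computes f) {x y : Fin n → Bool}
    (hxy : f x ≠ f y) :
    overlap (A.stateAfter x A.queries) (A.stateAfter y A.queries) ≤ 17 / 18 := by
  have hy : f y = !f x := by revert hxy; cases f x <;> cases f y <;> simp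
  have hpx := hA x
  have hpy := hA y
  have sx := A.prob_add_prob_not x (f x)
  have sy := A.prob_add_prob_not y (f x)
  rw [hy] at hpy
  -- AM-GM with `2 * √(3/8 * 2/3) = 1`, the larger weight going to the state less likely to give
  -- that answer. Each state then contributes at most `3/8 * 2/3 + 2/3 * 1/3 = 17/36`.
  have key : overlap (A.stateAfter x A.queries) (A.stateAfter y A.queries) ≤
      3 / 8 * A.prob x (f x) + 2 / 3 * A.prob y (f x) +
      (2 / 3 * A.prob x (!f x) + 3 / 8 * A.prob y (!f x)) := by
    unfold overlap prob
    simp only [Finset.mul_sum, ← Finset.sum_add_distrib]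
    refine Finset.sum_le_sum fun s _ => ?_
    generalize A.stateAfter x A.queries s = a
    generalize A.stateAfter y A.queries s = b
    have e := (abs_le.1 (abs_re_mul_conj_le a b)).2
    generalize (a * starRingEnd ℂ b).re = r at e ⊢
    by_cases h : A.output s = f x
    · simp only [h, if_true, mul_ite, mul_zero]
      cases f x <;> simp <;> nlinarith [sq_nonneg (3 * ‖a‖ - 4 * ‖b‖)]
    · have h' : A.output s = !f x := by revert h; cases f x <;> cases A.output s <;> simp
      simp only [h', if_true, mul_ite, mul_zero]
      cases f x <;> simp <;> nlinarith [sq_nonneg (4 * ‖a‖ - 3 * ‖b‖)]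
  linarith

end Algorithm

/-! ### The adversary bound for single bit flips -/

/-- The pairs `(x, i)` for which flipping bit `i` leads from `x ∈ X` to `Y`. -/
def flipEdges {n : ℕ} (X Y : Finset (Fin n → Bool)) : Finset ((Fin n → Bool) × Fin n) :=
  (X ×ˢ Finset.univ).filter fun e => flipBit e.1 e.2 ∈ Y

theorem sum_flipEdges_swap {n : ℕ} (X Y : Finset (Fin n → Bool)) (g : (Fin n → Bool) → Fin n → ℝ) :
    ∑ e ∈ flipEdges X Y, g (flipBit e.1 e.2) e.2 = ∑ e ∈ flipEdges Y X, g e.1 e.2 := by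
  refine Finset.sum_bij' (fun e _ => (flipBit e.1 e.2, e.2)) (fun e _ => (flipBit e.1 e.2, e.2))
    ?_ ?_ ?_ ?_ ?_ <;> simp +contextual [flipEdges]

theorem card_flipEdges_swap {n : ℕ} (X Y : Finset (Fin n → Bool)) :
    ((flipEdges X Y).card : ℝ) = (flipEdges Y X).card := by
  simpa using sum_flipEdges_swap X Y fun _ _ => 1

theorem le_card_flipEdges {n s : ℕ} {X Y : Finset (Fin n → Bool)}
    (h : ∀ x ∈ X, s ≤ (Finset.univ.filter fun i => flipBit x i ∈ Y).card) :
    X.card * s ≤ (flipEdges X Y).card := by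
  rw [flipEdges, Finset.card_filter, Finset.sum_product, ← smul_eq_mul]
  refine Finset.card_nsmul_le_sum _ _ _ fun x hx => ?_
  rw [← Finset.card_filter]
  exact h x hx

theorem sum_flipEdges_queryWeight_le {n d : ℕ} (X Y : Finset (Fin n → Bool))
    (ψ : (Fin n → Bool) → StateSpace n d) (hψ : ∀ x, ‖ψ x‖ = 1) :
    ∑ e ∈ flipEdges X Y, queryWeight (ψ e.1) e.2 ≤ X.card := by
  calc ∑ e ∈ flipEdges X Y, queryWeight (ψ e.1) e.2
      ≤ ∑ e ∈ X ×ˢ Finset.univ, queryWeight (ψ e.1) e.2 :=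
        Finset.sum_le_sum_of_subset_of_nonneg (Finset.filter_subset _ _)
          fun _ _ _ => queryWeight_nonneg _ _
    _ = X.card := by
        rw [Finset.sum_product]
        simp [sum_queryWeight, hψ]

/-- The adversary bound for pairs of inputs that differ in one bit: if every input of `X` can be
moved to `Y` by at least `s` bit flips and vice versa, then telling `X` and `Y` apart takes at least
`s / 36` queries. -/
theorem Algorithm.le_queries_of_flips {n s : ℕ} (A : Algorithm n) {f : (Fin n → Bool) → Bool}
    (hA : A.Computes f) {X Y : Finset (Fin n → Bool)} (hX : X.Nonempty)
    (hf : ∀ x ∈ X, ∀ y ∈ Y, f x ≠ f y)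
    (hXY : ∀ x ∈ X, s ≤ (Finset.univ.filter fun i => flipBit x i ∈ Y).card)
    (hYX : ∀ y ∈ Y, s ≤ (Finset.univ.filter fun i => flipBit y i ∈ X).card) :
    s ≤ 36 * A.queries := by
  set W : ℕ → ℝ := fun t => ∑ e ∈ flipEdges X Y,
    overlap (A.stateAfter e.1 t) (A.stateAfter (flipBit e.1 e.2) t) with hW
  have step (t : ℕ) : W t - W (t + 1) ≤ X.card + Y.card := by
    calc W t - W (t + 1)
        ≤ ∑ e ∈ flipEdges X Y, (queryWeight (A.stateAfter e.1 t) e.2 +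
            queryWeight (A.stateAfter (flipBit e.1 e.2) t) e.2) := by
          rw [hW, ← Finset.sum_sub_distrib]
          refine Finset.sum_le_sum fun e _ => ?_
          simp only [Algorithm.stateAfter, overlap_map]
          exact overlap_sub_overlap_oracle_le _ _ _ _
      _ = ∑ e ∈ flipEdges X Y, queryWeight (A.stateAfter e.1 t) e.2 +
            ∑ e ∈ flipEdges Y X, queryWeight (A.stateAfter e.1 t) e.2 := by
          rw [Finset.sum_add_distrib,
            sum_flipEdges_swap X Y fun x i => queryWeight (A.stateAfter x t) i]
      _ ≤ X.card + Y.card := add_le_add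
          (sum_flipEdges_queryWeight_le _ _ (A.stateAfter · t) (A.norm_stateAfter · t))
          (sum_flipEdges_queryWeight_le _ _ (A.stateAfter · t) (A.norm_stateAfter · t))
  have steps (t : ℕ) : W 0 - W t ≤ t * (X.card + Y.card) := by
    induction t with
    | zero => simp
    | succ t ih =>
      have := step t
      push_cast
      linarith
  have initial : W 0 = (flipEdges X Y).card := by
    have h (x y : Fin n → Bool) : overlap (A.stateAfter x 0) (A.stateAfter y 0) = 1 := by
      have : A.stateAfter y 0 = A.stateAfter x 0 := rfl
      rw [this, overlap_self, A.norm_stateAfter, one_pow]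
    simp [hW, h]
  have final : W A.queries ≤ 17 / 18 * (flipEdges X Y).card := by
    rw [mul_comm, ← nsmul_eq_mul]
    refine Finset.sum_le_card_nsmul _ _ _ fun e he => ?_
    simp only [flipEdges, Finset.mem_filter, Finset.mem_product] at he
    exact A.overlap_final_le hA (hf _ he.1.1 _ he.2)
  have hT := steps A.queries
  have cX : (X.card * s : ℝ) ≤ (flipEdges X Y).card := mod_cast le_card_flipEdges hXY
  have cY : (Y.card * s : ℝ) ≤ (flipEdges Y X).card := mod_cast le_card_flipEdges hYX
  rw [← card_flipEdges_swap] at cY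
  have pos : (0 : ℝ) < X.card + Y.card := by
    have : (0 : ℝ) < X.card := mod_cast hX.card_pos
    positivity
  have : (s : ℝ) ≤ 36 * A.queries := by
    refine le_of_mul_le_mul_right ?_ pos
    -- With `E` the number of pairs, `E / 18 ≤ queries * (|X| + |Y|)` and `s * (|X| + |Y|) ≤ 2 * E`;
    -- hence the constant 36.
    nlinarith
  exact_mod_cast this

theorem le_queryComplexity_of_flips {n s : ℕ} {f : (Fin n → Bool) → Bool}
    {X Y : Finset (Fin n → Bool)} (hX : X.Nonempty) (hf : ∀ x ∈ X, ∀ y ∈ Y, f x ≠ f y)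
    (hXY : ∀ x ∈ X, s ≤ (Finset.univ.filter fun i => flipBit x i ∈ Y).card)
    (hYX : ∀ y ∈ Y, s ≤ (Finset.univ.filter fun i => flipBit y i ∈ X).card) :
    ENNReal.ofReal (1 / 36 * s) ≤ (queryComplexity f : ℝ≥0∞) := by
  have h : (⌈(1 / 36 * s : ℝ)⌉₊ : ℕ∞) ≤ queryComplexity f := by
    refine le_iInf fun A => ?_
    have := A.1.le_queries_of_flips A.2 hX hf hXY hYX
    have : (s : ℝ) ≤ 36 * A.1.queries := mod_cast this
    exact_mod_cast Nat.ceil_le.2 (by linarith)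
  calc ENNReal.ofReal (1 / 36 * s) ≤ ENNReal.ofReal ⌈(1 / 36 * s : ℝ)⌉₊ :=
        ENNReal.ofReal_le_ofReal (Nat.le_ceil _)
    _ = ((⌈(1 / 36 * s : ℝ)⌉₊ : ℕ∞) : ℝ≥0∞) := by simp
    _ ≤ queryComplexity f := by exact_mod_cast h

end QuantumQuery

/-! ## Words over the two parentheses -/

/-- The height of the bit `b`, read as a parenthesis. -/
def bitHeight (b : Bool) : ℤ := if b then -1 else 1

/-- The number of opening minus the number of closing parentheses of a word. -/
def wordHeight (v : List Bool) : ℤ := (v.map bitHeight).sum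

@[simp]
theorem wordHeight_nil : wordHeight [] = 0 := rfl

@[simp]
theorem wordHeight_cons (b : Bool) (v : List Bool) :
    wordHeight (b :: v) = bitHeight b + wordHeight v := by
  simp [wordHeight]

@[simp]
theorem wordHeight_append (u v : List Bool) :
    wordHeight (u ++ v) = wordHeight u + wordHeight v := by
  simp [wordHeight]

@[simp]
theorem wordHeight_replicate (n : ℕ) (b : Bool) :
    wordHeight (List.replicate n b) = n * bitHeight b := by
  simp [wordHeight]

/-- All prefixes of the word `v` have their heights between `lo` and `hi`. -/
def HeightsWithin (lo hi : ℤ) (v : List Bool) : Prop :=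
  ∀ i, lo ≤ wordHeight (v.take i) ∧ wordHeight (v.take i) ≤ hi

theorem heightsWithin_nil {lo hi : ℤ} (h₀ : lo ≤ 0) (h₁ : 0 ≤ hi) : HeightsWithin lo hi [] := by
  intro i
  simp [h₀, h₁]

theorem HeightsWithin.mono {lo hi lo' hi' : ℤ} {v : List Bool} (h : HeightsWithin lo hi v)
    (h₀ : lo' ≤ lo) (h₁ : hi ≤ hi') : HeightsWithin lo' hi' v :=
  fun i => ⟨h₀.trans (h i).1, (h i).2.trans h₁⟩

theorem HeightsWithin.append {lo hi lo' hi' : ℤ} {u v : List Bool} (hu : HeightsWithin lo hi u)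
    (hv : HeightsWithin lo' hi' v) (h₀ : lo ≤ wordHeight u + lo')
    (h₁ : wordHeight u + hi' ≤ hi) : HeightsWithin lo hi (u ++ v) := by
  intro i
  rw [List.take_append, wordHeight_append]
  rcases le_total i u.length with h | h
  · simpa [Nat.sub_eq_zero_of_le h] using hu i
  · rw [List.take_of_length_le h]
    have := hv (i - u.length)
    constructor <;> linarith

theorem heightsWithin_replicate {lo hi : ℤ} (n : ℕ) (b : Bool) (h₀ : lo ≤ min 0 (n * bitHeight b))
    (h₁ : max 0 (n * bitHeight b) ≤ hi) : HeightsWithin lo hi (List.replicate n b) := by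
  intro i
  rw [List.take_replicate, wordHeight_replicate]
  cases b <;> simp [bitHeight] at * <;> omega

/-- The word `()()⋯()` of `2 * p` letters. -/
def zigzag : ℕ → List Bool
  | 0 => []
  | p + 1 => false :: true :: zigzag p

theorem length_zigzag (p : ℕ) : (zigzag p).length = 2 * p := by
  induction p with
  | zero => rfl
  | succ p ih => simp [zigzag, ih]; omega

theorem wordHeight_zigzag (p : ℕ) : wordHeight (zigzag p) = 0 := by
  induction p with
  | zero => rfl
  | succ p ih => simp [zigzag, ih, bitHeight]

theorem heightsWithin_zigzag (p : ℕ) : HeightsWithin 0 1 (zigzag p) := by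
  induction p with
  | zero => exact heightsWithin_nil le_rfl zero_le_one
  | succ p ih =>
    have h : HeightsWithin 0 1 ([false] ++ [true]) :=
      HeightsWithin.append (heightsWithin_replicate 1 false (by simp [bitHeight])
        (by simp [bitHeight])) (heightsWithin_replicate (lo := -1) (hi := 0) 1 true
          (by simp [bitHeight]) (by simp [bitHeight])) (by simp [bitHeight]) (by simp [bitHeight])
    exact h.append ih (by simp [bitHeight]) (by simp [bitHeight])

/-- The letter described by a bit. -/
def bitParen (b : Bool) : DyckStep := if b then DyckStep.D else DyckStep.U

theorem parenWord_eq_map {n : ℕ} (x : Fin n → Bool) :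
    parenWord x = (List.ofFn x).map bitParen := by
  rw [List.map_ofFn]
  rfl

theorem count_bitParen (v : List Bool) :
    ((v.map bitParen).count DyckStep.U : ℤ) - (v.map bitParen).count DyckStep.D = wordHeight v := by
  induction v with
  | nil => rfl
  | cons b v ih =>
    rw [wordHeight_cons, ← ih]
    cases b <;> simp [bitParen, bitHeight] <;> ring

theorem map_bitParen_mem_boundedDyckLanguage (k : ℕ) (v : List Bool) :
    v.map bitParen ∈ boundedDyckLanguage k ↔ wordHeight v = 0 ∧ HeightsWithin 0 k v := by
  constructor
  · rintro ⟨⟨p, hp⟩, hk⟩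
    refine ⟨?_, fun i => ?_⟩
    · have := p.count_U_eq_count_D
      rw [hp] at this
      rw [← count_bitParen]
      omega
    · have h₀ := p.count_D_le_count_U i
      have h₁ := hk i
      rw [hp] at h₀
      rw [← List.map_take] at h₀ h₁
      have := count_bitParen (v.take i)
      omega
  · rintro ⟨h, hk⟩
    refine ⟨⟨⟨v.map bitParen, ?_, fun i => ?_⟩, rfl⟩, fun i => ?_⟩
    · have := count_bitParen v
      omega
    · have := count_bitParen (v.take i)
      have := hk i
      rw [← List.map_take]
      omega
    · have := count_bitParen (v.take i)
      have := hk i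
      rw [← List.map_take]
      omega

theorem dyck_eq_true_iff {k n : ℕ} (x : Fin n → Bool) :
    dyck k n x = true ↔ wordHeight (List.ofFn x) = 0 ∧ HeightsWithin 0 k (List.ofFn x) := by
  rw [← map_bitParen_mem_boundedDyckLanguage, ← parenWord_eq_map]
  classical
  exact decide_eq_true_iff

/-! ## Counting bit flips -/

open Classical in
/-- The number of positions at which flipping a bit of `v` leads to a word of `S`. -/
noncomputable def flipCount (S : Set (List Bool)) (v : List Bool) : ℕ :=
  Nat.count (fun i => v.modify i (!·) ∈ S) v.length

theorem modify_append_left {α : Type*} (f : α → α) (u v : List α) {i : ℕ} (h : i < u.length) :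
    (u ++ v).modify i f = u.modify i f ++ v := by
  induction u generalizing i with
  | nil => simp at h
  | cons a u ih =>
    cases i with
    | zero => simp
    | succ i => simpa using ih (by simpa using h)

theorem modify_append_right {α : Type*} (f : α → α) (u v : List α) (i : ℕ) :
    (u ++ v).modify (u.length + i) f = u ++ v.modify i f := by
  induction u with
  | nil => simp
  | cons a u ih => simpa [Nat.add_right_comm] using ih

theorem flipCount_add_flipCount_le {S S₁ S₂ : Set (List Bool)} {u v : List Bool}
    (h₁ : ∀ u' ∈ S₁, u' ++ v ∈ S) (h₂ : ∀ v' ∈ S₂, u ++ v' ∈ S) :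
    flipCount S₁ u + flipCount S₂ v ≤ flipCount S (u ++ v) := by
  classical
  unfold flipCount
  rw [List.length_append, Nat.count_add]
  refine add_le_add (Nat.count_mono_left fun i hi h => ?_) (Nat.count_mono_left fun i _ h => ?_)
  · rw [modify_append_left _ _ _ hi]
    exact h₁ _ h
  · rw [modify_append_right]
    exact h₂ _ h

theorem flipCount_le_append_left {S S₁ : Set (List Bool)} {u v : List Bool}
    (h₁ : ∀ u' ∈ S₁, u' ++ v ∈ S) : flipCount S₁ u ≤ flipCount S (u ++ v) :=
  (Nat.le_add_right _ _).trans (flipCount_add_flipCount_le (S₂ := ∅) h₁ (by simp))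

theorem flipCount_le_append_right {S S₂ : Set (List Bool)} {u v : List Bool}
    (h₂ : ∀ v' ∈ S₂, u ++ v' ∈ S) : flipCount S₂ v ≤ flipCount S (u ++ v) :=
  (Nat.le_add_left _ _).trans (flipCount_add_flipCount_le (S₁ := ∅) (by simp) h₂)

theorem ofFn_flipBit {n : ℕ} (x : Fin n → Bool) (i : Fin n) :
    List.ofFn (QuantumQuery.flipBit x i) = (List.ofFn x).modify i (!·) := by
  refine List.ext_getElem (by simp) fun j hj _ => ?_
  rw [List.length_ofFn] at hj
  rw [List.getElem_modify, List.getElem_ofFn, List.getElem_ofFn]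
  by_cases h : (i : ℕ) = j
  · have : (⟨j, hj⟩ : Fin n) = i := Fin.ext h.symm
    simp [QuantumQuery.flipBit, this, h]
  · have : (⟨j, hj⟩ : Fin n) ≠ i := fun e => h (by rw [← e])
    simp [QuantumQuery.flipBit_of_ne x this, h]

theorem flipCount_ofFn_le {n : ℕ} {S : Set (List Bool)} {Y : Finset (Fin n → Bool)}
    (hY : ∀ y, List.ofFn y ∈ S → y ∈ Y) (x : Fin n → Bool) :
    flipCount S (List.ofFn x) ≤
      (Finset.univ.filter fun i => QuantumQuery.flipBit x i ∈ Y).card := by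
  classical
  unfold flipCount
  rw [List.length_ofFn, Nat.count_eq_card_filter_range]
  refine (Finset.card_le_card fun i hi => ?_).trans
    (Finset.card_map Fin.valEmbedding).le
  simp only [Finset.mem_filter, Finset.mem_range] at hi
  simp only [Finset.mem_map, Finset.mem_filter, Finset.mem_univ, true_and]
  exact ⟨⟨i, hi.1⟩, hY _ (by rw [ofFn_flipBit]; exact hi.2), rfl⟩

/-! ## Concatenations of words of two kinds -/

/-- `Shuffled A B a b v`: the word `v` is a concatenation, in some order, of `a` words of `A` and
`b` words of `B`. -/
inductive Shuffled (A B : Set (List Bool)) : ℕ → ℕ → List Bool → Prop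
  | nil : Shuffled A B 0 0 []
  | left {a b : ℕ} {w v : List Bool} : w ∈ A → Shuffled A B a b v → Shuffled A B (a + 1) b (w ++ v)
  | right {a b : ℕ} {w v : List Bool} :
      w ∈ B → Shuffled A B a b v → Shuffled A B a (b + 1) (w ++ v)

namespace Shuffled

variable {A B : Set (List Bool)} {a b : ℕ} {v : List Bool}

theorem symm (h : Shuffled A B a b v) : Shuffled B A b a v := by
  induction h with
  | nil => exact .nil
  | left hw _ ih => exact .right hw ih
  | right hw _ ih => exact .left hw ih

theorem exists_of_nonempty (hA : A.Nonempty) (hB : B.Nonempty) (a b : ℕ) :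
    ∃ v, Shuffled A B a b v := by
  induction a with
  | zero =>
    induction b with
    | zero => exact ⟨[], .nil⟩
    | succ b ih => exact ⟨_, .right hB.some_mem ih.choose_spec⟩
  | succ a ih => exact ⟨_, .left hA.some_mem ih.choose_spec⟩

theorem length_eq {L : ℕ} (hA : ∀ w ∈ A, w.length = L) (hB : ∀ w ∈ B, w.length = L)
    (h : Shuffled A B a b v) : v.length = (a + b) * L := by
  induction h with
  | nil => simp
  | left hw _ ih => rw [List.length_append, ih, hA _ hw]; ring
  | right hw _ ih => rw [List.length_append, ih, hB _ hw]; ring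

theorem wordHeight_eq (hA : ∀ w ∈ A, wordHeight w = 1) (hB : ∀ w ∈ B, wordHeight w = -1)
    (h : Shuffled A B a b v) : wordHeight v = a - b := by
  induction h with
  | nil => simp
  | left hw _ ih => rw [wordHeight_append, ih, hA _ hw]; push_cast; ring
  | right hw _ ih => rw [wordHeight_append, ih, hB _ hw]; push_cast; ring

/-- Every block shifts the height by one, so a block starts at most `a + b` away from zero and
strays at most `d` from its start. -/
theorem heightsWithin {d : ℤ} (hd : 0 ≤ d) (hA : ∀ w ∈ A, wordHeight w = 1 ∧ HeightsWithin (-d) d w)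
    (hB : ∀ w ∈ B, wordHeight w = -1 ∧ HeightsWithin (-d) d w) (h : Shuffled A B a b v) :
    HeightsWithin (-(d + (a + b))) (d + (a + b)) v := by
  induction h with
  | nil => exact heightsWithin_nil (by simpa using hd) (by simpa using hd)
  | left hw _ ih =>
    obtain ⟨h₁, h₂⟩ := hA _ hw
    refine (h₂.mono ?_ ?_).append ih ?_ ?_ <;> push_cast <;> omega
  | right hw _ ih =>
    obtain ⟨h₁, h₂⟩ := hB _ hw
    refine (h₂.mono ?_ ?_).append ih ?_ ?_ <;> push_cast <;> omega

theorem mul_le_flipCount {s : ℕ} (hA : ∀ w ∈ A, s ≤ flipCount B w) (h : Shuffled A B a b v) :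
    a * s ≤ flipCount {v' | Shuffled A B (a - 1) (b + 1) v'} v := by
  induction h with
  | nil => simp
  | @left a b w v hw hv ih =>
    -- The guard `0 < a` excludes the truncated `a - 1` at `a = 0`, where prepending `w` would give
    -- one `A`-block too many.
    have key : flipCount B w + flipCount {v' | 0 < a ∧ Shuffled A B (a - 1) (b + 1) v'} v ≤
        flipCount {v' | Shuffled A B (a + 1 - 1) (b + 1) v'} (w ++ v) := by
      refine flipCount_add_flipCount_le (fun w' hw' => .right hw' hv) ?_
      rintro v' ⟨ha, hv'⟩
      obtain ⟨a, rfl⟩ := Nat.exists_eq_succ_of_ne_zero ha.ne'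
      exact .left hw hv'
    have hs := hA w hw
    rcases a.eq_zero_or_pos with rfl | ha
    · omega
    · simp only [ha, true_and] at key
      rw [Nat.succ_mul]
      omega
  | right hw hv ih => exact ih.trans (flipCount_le_append_right fun v' hv' => .right hw hv')

end Shuffled

/-! ## Iterated threshold words -/

/-- The words of level `ℓ` with value `b`: at level `0` the single letter `b`; at level `ℓ + 1`
concatenations of `2 * m` words of level `ℓ`, of which `m` (for `b = false`) or `m + 1` (for
`b = true`) have value `true`, followed by an opening parenthesis. -/
def thresholdWords (m : ℕ) : ℕ → Bool → Set (List Bool)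
  | 0, b => {[b]}
  | ℓ + 1, false =>
    (· ++ [false]) '' {u | Shuffled (thresholdWords m ℓ false) (thresholdWords m ℓ true) m m u}
  | ℓ + 1, true =>
    (· ++ [false]) ''
      {u | Shuffled (thresholdWords m ℓ false) (thresholdWords m ℓ true) (m - 1) (m + 1) u}

/-- The length of the words of level `ℓ`. -/
def thresholdLength (m : ℕ) : ℕ → ℕ
  | 0 => 1
  | ℓ + 1 => 2 * m * thresholdLength m ℓ + 1

/-- The extra `+ 1` on the left absorbs the letter appended at each level, since `2 ≤ 2 * m`. -/
theorem thresholdLength_lt {m : ℕ} (hm : 1 ≤ m) (ℓ : ℕ) :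
    thresholdLength m ℓ + 1 ≤ 2 * (2 * m) ^ ℓ := by
  induction ℓ with
  | zero => simp [thresholdLength]
  | succ ℓ ih =>
    rw [thresholdLength, pow_succ]
    nlinarith [Nat.mul_le_mul_left (2 * m) ih]

theorem odd_thresholdLength (m ℓ : ℕ) : Odd (thresholdLength m ℓ) := by
  cases ℓ with
  | zero => exact odd_one
  | succ ℓ => exact ⟨m * thresholdLength m ℓ, by rw [thresholdLength]; ring⟩

theorem nonempty_thresholdWords (m ℓ : ℕ) (b : Bool) : (thresholdWords m ℓ b).Nonempty := by
  induction ℓ generalizing b with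
  | zero => exact ⟨[b], rfl⟩
  | succ ℓ ih => cases b <;> exact Set.Nonempty.image _ (Shuffled.exists_of_nonempty (ih _) (ih _) _ _)

theorem length_of_mem_thresholdWords {m : ℕ} (hm : 1 ≤ m) {ℓ : ℕ} {b : Bool} {w : List Bool}
    (hw : w ∈ thresholdWords m ℓ b) : w.length = thresholdLength m ℓ := by
  induction ℓ generalizing b w with
  | zero => rw [show w = [b] from hw]; rfl
  | succ ℓ ih =>
    cases b <;> obtain ⟨u, hu, rfl⟩ := hw <;>
      have h := Shuffled.length_eq (fun _ => ih) (fun _ => ih) hu <;>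
      simp only [List.length_append, List.length_singleton, thresholdLength, h]
    · ring
    · rw [show m - 1 + (m + 1) = 2 * m by omega]

theorem wordHeight_of_mem_thresholdWords {m : ℕ} (hm : 1 ≤ m) {ℓ : ℕ} {b : Bool} {w : List Bool}
    (hw : w ∈ thresholdWords m ℓ b) : wordHeight w = bitHeight b := by
  induction ℓ generalizing b w with
  | zero => rw [show w = [b] from hw]; simp
  | succ ℓ ih =>
    cases b <;> obtain ⟨u, hu, rfl⟩ := hw <;>
      have h := Shuffled.wordHeight_eq (fun _ => ih) (fun _ => ih) hu <;>
      simp [h, bitHeight]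
    omega

/-- Blocks have height `±1` at every level, so the ranges of the levels add rather than multiply;
this keeps the depth linear in `ℓ * m`. -/
theorem heightsWithin_of_mem_thresholdWords {m : ℕ} (hm : 1 ≤ m) {ℓ : ℕ} {b : Bool} {w : List Bool}
    (hw : w ∈ thresholdWords m ℓ b) :
    HeightsWithin (-(1 + 2 * m * ℓ)) (1 + 2 * m * ℓ) w := by
  induction ℓ generalizing b w with
  | zero =>
    rw [show w = [b] from hw]
    refine heightsWithin_replicate 1 b ?_ ?_ <;> cases b <;> simp [bitHeight]
  | succ ℓ ih =>
    have hd : (0 : ℤ) ≤ 2 * m * ℓ := by positivity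
    have e : (2 * m * (ℓ + 1 : ℕ) : ℤ) = 2 * m * ℓ + 2 * m := by push_cast; ring
    rw [e]
    generalize (2 * m * ℓ : ℤ) = d at ih hd ⊢
    cases b <;> obtain ⟨u, hu, rfl⟩ := hw <;>
      have h := Shuffled.wordHeight_eq (fun _ => wordHeight_of_mem_thresholdWords hm)
        (fun _ => wordHeight_of_mem_thresholdWords hm) hu <;>
      have h' := Shuffled.heightsWithin (d := 1 + d) (by omega)
        (fun _ hw => ⟨wordHeight_of_mem_thresholdWords (b := false) hm hw, ih hw⟩)
        (fun _ hw => ⟨wordHeight_of_mem_thresholdWords (b := true) hm hw, ih hw⟩) hu <;>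
      refine (h'.mono ?_ ?_).append (heightsWithin_replicate (lo := 0) (hi := 1) 1 false
        (by simp [bitHeight]) (by simp [bitHeight])) ?_ ?_ <;> push_cast <;> omega

theorem pow_le_flipCount_thresholdWords (m ℓ : ℕ) {b : Bool} {w : List Bool}
    (hw : w ∈ thresholdWords m ℓ b) : m ^ ℓ ≤ flipCount (thresholdWords m ℓ (!b)) w := by
  induction ℓ generalizing b w with
  | zero =>
    rw [show w = [b] from hw]
    simp [flipCount, thresholdWords, Nat.count_one]
  | succ ℓ ih =>
    cases b <;> obtain ⟨u, hu, rfl⟩ := hw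
    · have h := Shuffled.mul_le_flipCount (fun _ => ih (b := false)) hu
      rw [pow_succ']
      exact h.trans (flipCount_le_append_left fun u' hu' => Set.mem_image_of_mem _ hu')
    · have h := Shuffled.mul_le_flipCount (fun _ => ih (b := true)) (Shuffled.symm hu)
      -- For `m = 0` the truncated `m - 1` breaks the block count, but then the bound is `0`.
      rcases m.eq_zero_or_pos with rfl | hm
      · simp
      rw [Nat.add_sub_cancel, Nat.sub_add_cancel hm] at h
      rw [pow_succ']
      exact (Nat.mul_le_mul_right _ m.le_succ).trans (h.trans
        (flipCount_le_append_left fun u' hu' => Set.mem_image_of_mem _ (Shuffled.symm hu')))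

/-! ## Embedding into Dyck words -/

/-- The word `w` raised to height `K`, brought down by `K + 1` and followed by `()()⋯()`. -/
def embedWord (K p : ℕ) (w : List Bool) : List Bool :=
  List.replicate K false ++ (w ++ (List.replicate (K + 1) true ++ zigzag p))

theorem length_embedWord (K p : ℕ) (w : List Bool) :
    (embedWord K p w).length = w.length + (2 * K + 1) + 2 * p := by
  simp only [embedWord, List.length_append, List.length_replicate, length_zigzag]
  omega

theorem wordHeight_embedWord (K p : ℕ) (w : List Bool) :
    wordHeight (embedWord K p w) = wordHeight w - 1 := by
  simp only [embedWord, wordHeight_append, wordHeight_replicate, wordHeight_zigzag, bitHeight]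
  push_cast
  simp
  ring

/-- The prefix lifts `w` from `[-K, K]` to `[0, 2 * K]`; height `1` makes the `K + 1` closing
parentheses end exactly at zero, and the padding needs only height `1`. -/
theorem heightsWithin_embedWord {K p : ℕ} (hK : 1 ≤ K) {w : List Bool} (hw : wordHeight w = 1)
    (h : HeightsWithin (-K) K w) : HeightsWithin 0 (2 * K) (embedWord K p w) := by
  have h₁ : HeightsWithin (-(K + 1)) 0 (List.replicate (K + 1) true ++ zigzag p) :=
    (heightsWithin_replicate (K + 1) true (by simp [bitHeight]) (by simp [bitHeight])).append
      (heightsWithin_zigzag p) (by simp [bitHeight]) (by simp [bitHeight])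
  have h₂ : HeightsWithin (-K) K (w ++ (List.replicate (K + 1) true ++ zigzag p)) :=
    h.append h₁ (by omega) (by omega)
  exact (heightsWithin_replicate K false (by simp [bitHeight]) (by simp [bitHeight]; omega)).append
    h₂ (by simp [bitHeight]) (by simp [bitHeight]; omega)

theorem flipCount_le_embedWord (K p : ℕ) (S : Set (List Bool)) (w : List Bool) :
    flipCount S w ≤ flipCount (embedWord K p '' S) (embedWord K p w) :=
  (flipCount_le_append_left (S := (· ++ (List.replicate (K + 1) true ++ zigzag p)) '' S)
    fun _ hw => Set.mem_image_of_mem _ hw).trans (flipCount_le_append_right (by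
      rintro _ ⟨w', hw', rfl⟩
      exact ⟨w', hw', rfl⟩))

theorem le_queryComplexity_dyck {m ℓ k n p : ℕ} (hm : 1 ≤ m) (hk : 2 * (1 + 2 * m * ℓ) ≤ k)
    (hn : thresholdLength m ℓ + (2 * (1 + 2 * m * ℓ) + 1) + 2 * p = n) :
    ENNReal.ofReal (1 / 36 * (m ^ ℓ : ℕ)) ≤ (QuantumQuery.queryComplexity (dyck k n) : ℝ≥0∞) := by
  classical
  set K := 1 + 2 * m * ℓ with hK
  let X (b : Bool) : Finset (Fin n → Bool) :=
    Finset.univ.filter fun x => List.ofFn x ∈ embedWord K p '' thresholdWords m ℓ b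
  have flips (b : Bool) : ∀ x ∈ X b,
      m ^ ℓ ≤ (Finset.univ.filter fun i => QuantumQuery.flipBit x i ∈ X (!b)).card := by
    intro x hx
    obtain ⟨w, hw, hwx⟩ := (Finset.mem_filter.1 hx).2
    refine (pow_le_flipCount_thresholdWords m ℓ hw).trans
      ((flipCount_le_embedWord K p _ w).trans ?_)
    rw [hwx]
    exact flipCount_ofFn_le (fun y hy => Finset.mem_filter.2 ⟨Finset.mem_univ _, hy⟩) x
  refine QuantumQuery.le_queryComplexity_of_flips (X := X false) (Y := X true) ?_ ?_
    (flips false) (flips true)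
  · obtain ⟨w, hw⟩ := nonempty_thresholdWords m ℓ false
    have hl : (embedWord K p w).length = n := by
      rw [length_embedWord, length_of_mem_thresholdWords hm hw, hn]
    subst hl
    exact ⟨(embedWord K p w).get, Finset.mem_filter.2
      ⟨Finset.mem_univ _, w, hw, (List.ofFn_get _).symm⟩⟩
  · intro x hx y hy
    obtain ⟨w, hw, hwx⟩ := (Finset.mem_filter.1 hx).2
    obtain ⟨v, hv, hvy⟩ := (Finset.mem_filter.1 hy).2
    have hx' : dyck k n x = true := by
      have h₁ : wordHeight w = 1 := wordHeight_of_mem_thresholdWords hm hw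
      have h₂ := heightsWithin_of_mem_thresholdWords hm hw
      rw [dyck_eq_true_iff, ← hwx, wordHeight_embedWord, h₁]
      refine ⟨rfl, (heightsWithin_embedWord (by omega) h₁ (h₂.mono ?_ ?_)).mono le_rfl ?_⟩
      · rw [hK]; push_cast; rfl
      · rw [hK]; push_cast; rfl
      · exact_mod_cast hk
    -- The total height is `-2`, so the word is not balanced.
    have hy' : dyck k n y ≠ true := by
      rw [Ne, dyck_eq_true_iff, ← hvy, wordHeight_embedWord, wordHeight_of_mem_thresholdWords hm hv]
      simp [bitHeight]
    rw [hx']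
    exact hy'.symm

theorem theorem1 :
    ∃ c₁ c₂ : ℕ, 0 < c₁ ∧ 0 < c₂ ∧ ∃ c : ℝ, 0 < c ∧
      ∀ ℓ m : ℕ, 1 ≤ ℓ → 1 ≤ m →
        ENNReal.ofReal (c * (m : ℝ) ^ ℓ) ≤
          (QuantumQuery.queryComplexity (dyck (c₁ * ℓ * m) (c₂ * (2 * m) ^ ℓ)) : ℝ≥0∞) := by
  -- Depth: `2 + 4 * m * ℓ ≤ 6 * m * ℓ`. Length: the threshold word takes less than `2 * (2 * m) ^
  -- ℓ` letters and the frame `4 * m * ℓ + 3`, where `4 * m * ℓ ≤ 2 * (2 * m) ^ ℓ`.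
  refine ⟨6, 6, by norm_num, by norm_num, 1 / 36, by norm_num, fun ℓ m hℓ hm => ?_⟩
  have hlm : 1 ≤ m * ℓ := Nat.mul_pos hm hℓ
  have hpow : 2 * (m * ℓ) ≤ (2 * m) ^ ℓ := by
    obtain ⟨j, rfl⟩ := Nat.exists_eq_add_of_le' hℓ
    have h₁ : j + 1 ≤ 2 ^ j := Nat.lt_two_pow_self
    have h₂ : 2 ^ j ≤ (2 * m) ^ j := Nat.pow_le_pow_left (by omega) j
    rw [pow_succ]
    nlinarith [h₁.trans h₂]
  have hlen := thresholdLength_lt hm ℓ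
  -- The word and its frame both have odd length, so an even number of letters remains, which `p`
  -- pairs `()` fill exactly.
  obtain ⟨q, hq⟩ := odd_thresholdLength m ℓ
  have e : 2 * m * ℓ = 2 * (m * ℓ) := by ring
  have h := le_queryComplexity_dyck (m := m) (ℓ := ℓ) (k := 6 * ℓ * m) (n := 6 * (2 * m) ^ ℓ)
    (p := 3 * (2 * m) ^ ℓ - (q + 1 + (1 + 2 * m * ℓ))) hm
    (by rw [show 6 * ℓ * m = 6 * (m * ℓ) by ring, e]; omega) (by rw [e]; omega)
  simpa only [Nat.cast_pow] using h
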